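/- Let $N\ge 1$, $K\ge 0$ be integers and let $V:\mathbb{R}\to\mathbb{R}$ be such that $\int_{\mathbb R} |x|^k e^{-NV(x)}\,dx<\infty$ for all $k\ge 0$. For a vector $v=(v_1,\dots,v_n)$ let $\triangle(v)=\det[v_i^{\,j-1}]_{1\le i,j\le n}=\prod_{i<j}(v_j-v_i)$. Consider the ensemble of $N\times N$ Hermitian matrices $H$ with eigenvalue density $$P_N(\hat x)=Z_N^{-1}\exp\Big[-N\sum_{i=1}^N V(x_i)\Big]\triangle^2(\hat x),\qquad \hat x=(x_1,\dots,x_N)\in\mathbb{R}^N,$$ where $Z_N$ is the normalization constant, let $\mathcal Z_N[z,H]=\det(z-H)$, and for a function of the eigenvalues $\hat x$ of $H$ let $\langle\,\cdot\,\rangle_H$ denote its integral against $P_N(\hat x)\,d\hat x$. Let $\pi_k(x)=x^k+\dots$ be the monic orthogonal polynomials, $$\int_{\mathbb R}\pi_k(x)\pi_m(x)e^{-NV(x)}dx=c_k^2\,\delta_{km},$$ let $$h_k(\epsilon)=\frac1{2\pi i}\int_{\mathbb R}\frac{e^{-NV(x)}\pi_k(x)}{x-\epsilon}\,dx\quad(\epsilon\in\mathbb{C}\setminus\mathbb{R})$$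 be their Cauchy transforms, and let $\gamma_{N-1}=-2\pi i/c_{N-1}^2$. Let $\epsilon_1,\dots,\epsilon_K$ and $\mu_1,\dots,\mu_K$ be complex numbers with $\operatorname{Im}\epsilon_j\ne 0$ for all $j$, such that the $\epsilon_j$ are pairwise distinct, the $\mu_j$ are pairwise distinct, and $\epsilon_i\neq\mu_j$ for all $i,j$. Then $\prod_{j=1}^K \mathcal Z_N[\mu_j,H]/\mathcal Z_N[\epsilon_j,H]$ is integrable with respect to $P_N(\hat x)\,d\hat x$, and $$\Big\langle\prod_{j=1}^K\frac{\mathcal Z_N[\mu_j,H]}{\mathcal Z_N[\epsilon_j,H]}\Big\rangle_H=(-1)^{\frac{K(K-1)}2}\,\gamma_{N-1}^K\,\frac{\triangle(\hat\epsilon,\hat\mu)}{\triangle^2(\hat\epsilon)\,\triangle^2(\hat\mu)}\,\det\big[W_{II,N}(\epsilon_i,\mu_j)\big]_{1\le i,j\le K},$$ where $(\hat\epsilon,\hat\mu)=(\epsilon_1,\dots,\epsilon_K,\mu_1,\dots,\mu_K)$ and $$W_{II,N}(\epsilon,\mu)=\frac{h_N(\epsilon)\pi_{N-1}(\mu)-h_{N-1}(\epsilon)\pi_N(\mu)}{\epsilon-\mu}.$$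 -/

import Mathlib

open MeasureTheory Polynomial

noncomputable section

namespace UnitaryEnsemble

/-- The weight `exp (-N V(x))` on the real line. -/
def weight (V : ℝ → ℝ) (N : ℕ) (x : ℝ) : ℝ := Real.exp (-(N : ℝ) * V x)

/-- The standing assumption that makes the orthogonal polynomials and the ensemble exist:
all moments of the weight `exp (-N V(x))` are finite. -/
def FiniteMoments (V : ℝ → ℝ) (N : ℕ) : Prop :=
  ∀ k : ℕ, Integrable (fun x : ℝ => x ^ k * weight V N x)

/-- The Vandermonde determinant `Δ(v) = det (v_i ^ (j-1)) = ∏_{i<j} (v_j - v_i)`. -/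
def vdet {R : Type*} [CommRing R] {n : ℕ} (v : Fin n → R) : R := (Matrix.vandermonde v).det

/-- The unnormalised joint eigenvalue density. -/
def unnormalizedDensity (V : ℝ → ℝ) (N : ℕ) (x : Fin N → ℝ) : ℝ :=
  Real.exp (-(N : ℝ) * ∑ i, V (x i)) * vdet x ^ 2

/-- The normalization constant `Z_N`. -/
def partitionFunction (V : ℝ → ℝ) (N : ℕ) : ℝ := ∫ x : Fin N → ℝ, unnormalizedDensity V N x

/-- The joint eigenvalue density `P_N`. -/
def eigenvalueDensity (V : ℝ → ℝ) (N : ℕ) (x : Fin N → ℝ) : ℝ :=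
  (partitionFunction V N)⁻¹ * unnormalizedDensity V N x

/-- The characteristic polynomial `det (z - H)` of an `N × N` matrix. -/
def charDet {N : ℕ} (z : ℂ) (H : Matrix (Fin N) (Fin N) ℂ) : ℂ := (z • 1 - H).det

/-- The integrand of the ensemble average of a function `f` of `H` that depends only on the
eigenvalues of `H`: the value of `f` at a matrix with eigenvalues `x`, times `P_N(x)`. -/
def averageIntegrand (V : ℝ → ℝ) (N : ℕ) (f : Matrix (Fin N) (Fin N) ℂ → ℂ)
    (x : Fin N → ℝ) : ℂ :=
  (eigenvalueDensity V N x : ℂ) * f (Matrix.diagonal fun i => (x i : ℂ))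

/-- The ensemble average of a function of the eigenvalues of `H`. -/
def average (V : ℝ → ℝ) (N : ℕ) (f : Matrix (Fin N) (Fin N) ℂ → ℂ) : ℂ :=
  ∫ x : Fin N → ℝ, averageIntegrand V N f x

/-- The product of ratios `∏_j det (μ_j - H) / det (ε_j - H)`. -/
def charRatio {N K : ℕ} (ε μ : Fin K → ℂ) (H : Matrix (Fin N) (Fin N) ℂ) : ℂ :=
  ∏ j, charDet (μ j) H / charDet (ε j) H

/-- The bilinear form `∫ p(x) q(x) exp (-N V(x)) dx` on real polynomials. -/
def pairing (V : ℝ → ℝ) (N : ℕ) (p q : ℝ[X]) : ℝ :=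
  ∫ x : ℝ, p.eval x * q.eval x * weight V N x

/-- The monic orthogonal polynomials `π_k` for the weight `exp (-N V(x))`,
by the Gram-Schmidt procedure applied to the monomials (see `monicOrthPoly_spec`). -/
def monicOrthPoly (V : ℝ → ℝ) (N : ℕ) (k : ℕ) : ℝ[X] :=
  X ^ k - ∑ j : Fin k,
    C (pairing V N (X ^ k) (monicOrthPoly V N j) /
      pairing V N (monicOrthPoly V N j) (monicOrthPoly V N j)) * monicOrthPoly V N j
termination_by k
decreasing_by all_goals exact j.2

/-- `c_k ^ 2 = ∫ π_k(x) ^ 2 exp (-N V(x)) dx`. -/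
def normSq (V : ℝ → ℝ) (N k : ℕ) : ℝ := pairing V N (monicOrthPoly V N k) (monicOrthPoly V N k)

/-- `γ_k = - 2 π i / c_k ^ 2`. -/
def gammaCoeff (V : ℝ → ℝ) (N k : ℕ) : ℂ := -(2 * (Real.pi : ℂ) * Complex.I) / (normSq V N k : ℂ)

/-- The value of `π_k` at a complex point. -/
def orthEval (V : ℝ → ℝ) (N k : ℕ) (z : ℂ) : ℂ := aeval z (monicOrthPoly V N k)

/-- The Cauchy transform `h_k` of `π_k`. -/
def cauchyTransform (V : ℝ → ℝ) (N k : ℕ) (z : ℂ) : ℂ :=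
  1 / (2 * (Real.pi : ℂ) * Complex.I) *
    ∫ x : ℝ, ((weight V N x * (monicOrthPoly V N k).eval x : ℝ) : ℂ) / ((x : ℂ) - z)

/-- The kernel `W_{II,N}(z, m)`, for `N ≥ 1`. -/
def kernelII (V : ℝ → ℝ) (N : ℕ) (z m : ℂ) : ℂ :=
  (cauchyTransform V N N z * orthEval V N (N - 1) m -
    cauchyTransform V N (N - 1) z * orthEval V N N m) / (z - m)

section Spec

variable {V : ℝ → ℝ} {N : ℕ}

theorem FiniteMoments.integrable_poly (hV : FiniteMoments V N) (p : ℝ[X]) :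
    Integrable (fun x : ℝ => p.eval x * weight V N x) := by
  induction p using Polynomial.induction_on' with
  | add p q hp hq =>
    simp only [eval_add, add_mul]
    exact hp.add hq
  | monomial n a => simpa [mul_assoc] using (hV n).const_mul a

theorem FiniteMoments.integrable_mul (hV : FiniteMoments V N) (p q : ℝ[X]) :
    Integrable (fun x : ℝ => p.eval x * q.eval x * weight V N x) := by
  simpa using hV.integrable_poly (p * q)

theorem pairing_comm (p q : ℝ[X]) : pairing V N p q = pairing V N q p := by
  simp only [pairing, mul_comm (p.eval _)]

theorem pairing_sub_left (hV : FiniteMoments V N) (p q r : ℝ[X]) :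
    pairing V N (p - q) r = pairing V N p r - pairing V N q r := by
  unfold pairing
  rw [← integral_sub (hV.integrable_mul p r) (hV.integrable_mul q r)]
  simp [sub_mul]

theorem pairing_sum_left (hV : FiniteMoments V N) {ι : Type*} (s : Finset ι) (a : ι → ℝ)
    (p : ι → ℝ[X]) (r : ℝ[X]) :
    pairing V N (∑ i ∈ s, C (a i) * p i) r = ∑ i ∈ s, a i * pairing V N (p i) r := by
  unfold pairing
  simp_rw [← integral_const_mul]
  rw [← integral_finsetSum]
  · simp [eval_finsetSum, Finset.sum_mul, mul_assoc]
  · intro i _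
    exact (hV.integrable_mul (p i) r).const_mul (a i)

theorem pairing_self_pos (hV : FiniteMoments V N) {p : ℝ[X]} (hp : p ≠ 0) :
    0 < pairing V N p p := by
  unfold pairing
  rw [integral_pos_iff_support_of_nonneg]
  · have hsub : (p.roots.toFinset : Set ℝ)ᶜ ⊆
        Function.support (fun x : ℝ => p.eval x * p.eval x * weight V N x) := by
      intro x hx
      have : p.eval x ≠ 0 := by simpa [hp] using hx
      simp [this, weight, Real.exp_ne_zero]
    refine lt_of_lt_of_le ?_ (measure_mono hsub)
    have h0 : volume (p.roots.toFinset : Set ℝ) = 0 := p.roots.toFinset.measure_zero volume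
    rw [measure_compl (Finset.measurableSet _) (by simp [h0]), h0]
    simp
  · intro x
    exact mul_nonneg (mul_self_nonneg _) (Real.exp_pos _).le
  · exact hV.integrable_mul p p

theorem monicOrthPoly_monic_natDegree (k : ℕ) :
    (monicOrthPoly V N k).Monic ∧ (monicOrthPoly V N k).natDegree = k := by
  induction k using Nat.strong_induction_on with
  | _ k ih =>
    have hdeg : (∑ j : Fin k,
        C (pairing V N (X ^ k) (monicOrthPoly V N j) /
          pairing V N (monicOrthPoly V N j) (monicOrthPoly V N j)) *
            monicOrthPoly V N j).degree < k := by
      refine (Polynomial.degree_sum_le _ _).trans_lt ?_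
      refine (Finset.sup_lt_iff (WithBot.bot_lt_coe k)).2 ?_
      intro j _
      rw [← smul_eq_C_mul]
      refine (degree_smul_le _ _).trans_lt ?_
      rw [degree_eq_natDegree (ih j j.2).1.ne_zero, (ih j j.2).2]
      exact WithBot.coe_lt_coe.2 j.2
    rw [monicOrthPoly]
    have hd2 : (X ^ k : ℝ[X]).degree = k := degree_X_pow k
    refine ⟨(monic_X_pow k).sub_of_left (by rwa [hd2]), ?_⟩
    apply natDegree_eq_of_degree_eq_some
    rw [degree_sub_eq_left_of_degree_lt (by rwa [hd2]), hd2]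

/-- The polynomials `π_k` are monic of degree `k` and mutually orthogonal, and `c_k ^ 2 > 0`. -/
theorem monicOrthPoly_spec (hV : FiniteMoments V N) :
    (∀ k, (monicOrthPoly V N k).Monic ∧ (monicOrthPoly V N k).natDegree = k) ∧
    (∀ k m, k ≠ m → ∫ x : ℝ, (monicOrthPoly V N k).eval x * (monicOrthPoly V N m).eval x *
      weight V N x = 0) ∧
    (∀ k, 0 < normSq V N k) := by
  have hpos : ∀ k, 0 < normSq V N k := fun k =>
    pairing_self_pos hV (monicOrthPoly_monic_natDegree k).1.ne_zero
  have key : ∀ k, ∀ m < k, pairing V N (monicOrthPoly V N k) (monicOrthPoly V N m) = 0 := by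
    intro k
    induction k using Nat.strong_induction_on with
    | _ k ih =>
      intro m hm
      rw [monicOrthPoly, pairing_sub_left hV, pairing_sum_left hV,
        Finset.sum_eq_single (⟨m, hm⟩ : Fin k)]
      · have := (hpos m).ne'
        simp only [normSq] at this
        rw [div_mul_cancel₀ _ this, sub_self]
      · intro j _ hj
        have hj' : (j : ℕ) ≠ m := fun h => hj (Fin.ext h)
        rcases lt_or_gt_of_ne hj' with h | h
        · rw [pairing_comm (monicOrthPoly V N j) (monicOrthPoly V N m), ih m hm j h, mul_zero]
        · rw [ih j j.2 m h, mul_zero]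
      · simp
  refine ⟨monicOrthPoly_monic_natDegree, ?_, hpos⟩
  intro k m hkm
  change pairing V N _ _ = 0
  rcases lt_or_gt_of_ne hkm with h | h
  · rw [pairing_comm]; exact key m k h
  · exact key k m h

end Spec

end UnitaryEnsemble

end

/-! Write Δ(x) as the determinant of the values π_l(x_i). The other factor Δ(x), multiplied by the
ratio ∏ (μ_j - x_i)/(ε_j - x_i) and by the Cauchy determinant det[1/(μ_j - ε_a)], is a single
(N+K)×(N+K) determinant: its rows are the functions π_l and 1/(· - ε_a), its columns the points x_i
and μ_j (`det_fromBlocks_vandermonde_cauchy`).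

Andréief's identity with the μ-columns held constant (`integrable_integral_det_mul_det`) then
integrates out x. By orthogonality the upper left block becomes diag(c_0², …, c_{N-1}²), so the
integral is N! ∏ c_l² times a K×K Schur complement with entries 1/(μ_j - ε_a) - ∑_{l<N} (∫ e^{-NV}
π_l/(x - ε_a)) π_l(μ_j)/c_l².

A Christoffel-Darboux formula for Cauchy transforms (`sum_weightedCauchy_mul_orthEval`) turns each
entry into γ_{N-1} W_{II,N}(ε_a, μ_j). The factor N! ∏ c_l² is Z_N, which is the case K = 0, and the
reciprocal of the Cauchy determinant is the Vandermonde prefactor with its sign. -/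

noncomputable section

namespace UnitaryEnsemble

/-! ### Vandermonde, Cauchy and mixed determinants over a field -/

section Determinants

variable {F : Type*} [Field F]

theorem det_vandermonde_eq_prod_ite {R : Type*} [CommRing R] {n : ℕ} (v : Fin n → R) :
    (Matrix.vandermonde v).det = ∏ i, ∏ j, if i < j then v j - v i else 1 := by
  rw [Matrix.det_vandermonde]
  refine Finset.prod_congr rfl fun i _ => ?_
  rw [← Finset.prod_filter]
  congr 1
  ext j
  simp

theorem det_vandermonde_append {R : Type*} [CommRing R] {m n : ℕ} (u : Fin m → R)
    (v : Fin n → R) :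
    (Matrix.vandermonde (Fin.append u v)).det =
      (Matrix.vandermonde u).det * (Matrix.vandermonde v).det * ∏ i, ∏ j, (v j - u i) := by
  have h1 : ∀ (i : Fin m) (j : Fin n), (i : ℕ) < m + j := fun i j => by omega
  have h2 : ∀ (i : Fin m) (j : Fin n), ¬ m + (j : ℕ) < i := fun i j => by omega
  simp only [det_vandermonde_eq_prod_ite, Fin.prod_univ_add, Fin.append_left, Fin.append_right,
    Fin.lt_def, Fin.val_castAdd, Fin.val_natAdd, add_lt_add_iff_left, h1, h2, if_true, if_false,
    Finset.prod_const_one, Finset.prod_mul_distrib]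
  ring

/-- Each unordered pair of indices occurs twice with opposite signs, which gives the square and one
factor -1 for each of the n(n-1)/2 pairs. -/
theorem prod_prod_erase_sub {R : Type*} [CommRing R] {n : ℕ} (v : Fin n → R) :
    ∏ i, ∏ j ∈ Finset.univ.erase i, (v i - v j) =
      (-1) ^ (n * (n - 1) / 2) * (Matrix.vandermonde v).det ^ 2 := by
  have hsplit : ∀ i : Fin n, ∏ j ∈ Finset.univ.erase i, (v i - v j) =
      (∏ j, if i < j then v i - v j else 1) * ∏ j, if j < i then v i - v j else 1 := by
    intro i
    rw [← Finset.prod_mul_distrib, ← Finset.mul_prod_erase _ _ (Finset.mem_univ i)]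
    simp only [lt_irrefl, if_false, one_mul]
    refine Finset.prod_congr rfl fun j hj => ?_
    rcases lt_or_gt_of_ne (Finset.ne_of_mem_erase hj) with h | h
    · simp [h, h.not_gt]
    · simp [h, h.not_gt]
  have hsign : ∏ i : Fin n, ∏ j : Fin n, (if i < j then (-1 : R) else 1) =
      (-1) ^ (n * (n - 1) / 2) := by
    have hrow : ∀ i : Fin n, ∏ j : Fin n, (if i < j then (-1 : R) else 1) =
        (-1) ^ (n - 1 - (i : ℕ)) := by
      intro i
      rw [← Finset.prod_filter, Finset.prod_const, ← Fin.card_Ioi]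
      congr 2
      ext j
      simp
    simp only [hrow]
    rw [Fin.prod_univ_eq_prod_range (fun i => (-1 : R) ^ (n - 1 - i)), Finset.prod_pow_eq_pow_sum,
      Finset.sum_range_reflect (fun i => i), Finset.sum_range_id]
  have hneg : ∏ i : Fin n, ∏ j : Fin n, (if i < j then v i - v j else 1) =
      (-1) ^ (n * (n - 1) / 2) * (Matrix.vandermonde v).det := by
    rw [← hsign, det_vandermonde_eq_prod_ite]
    simp only [← Finset.prod_mul_distrib]
    refine Finset.prod_congr rfl fun i _ => Finset.prod_congr rfl fun j _ => ?_
    split_ifs <;> ring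
  simp only [hsplit]
  rw [Finset.prod_mul_distrib, hneg,
    Finset.prod_comm (f := fun i j : Fin n => (if j < i then v i - v j else 1 : R)),
    ← det_vandermonde_eq_prod_ite]
  ring

theorem eval_eq_sum_basis {n : ℕ} {v : Fin n → F} (hv : Function.Injective v) {f : F[X]}
    (hf : f.degree < n) (x : F) :
    f.eval x = ∑ j, f.eval (v j) * (Lagrange.basis Finset.univ v j).eval x := by
  conv_lhs => rw [Lagrange.eq_interpolate (s := Finset.univ) (v := v) (f := f) hv.injOn (by simpa using hf)]
  simp [Lagrange.interpolate_apply, eval_finsetSum]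

/-- The remainder modulo the nodal polynomial agrees with f at the nodes and has degree below n, so
it is the Lagrange interpolant. -/
theorem eval_eq_divByMonic_nodal_add {n : ℕ} {v : Fin n → F} (hv : Function.Injective v)
    (f : F[X]) (x : F) :
    f.eval x = (f /ₘ Lagrange.nodal Finset.univ v).eval x * (Lagrange.nodal Finset.univ v).eval x +
      ∑ j, f.eval (v j) * (Lagrange.basis Finset.univ v j).eval x := by
  have hm : (Lagrange.nodal Finset.univ v).Monic := Lagrange.nodal_monic
  have hdeg : (f %ₘ Lagrange.nodal Finset.univ v).degree < n := by
    refine (degree_modByMonic_lt f hm).trans_le ?_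
    simp [Lagrange.degree_nodal]
  have h : ∀ j, (f %ₘ Lagrange.nodal Finset.univ v).eval (v j) = f.eval (v j) := by
    intro j
    conv_rhs => rw [← modByMonic_add_div f (Lagrange.nodal Finset.univ v)]
    simp [Lagrange.eval_nodal_at_node (v := v) (Finset.mem_univ j)]
  conv_lhs => rw [← modByMonic_add_div f (Lagrange.nodal Finset.univ v)]
  rw [eval_add, eval_mul, eval_eq_sum_basis hv hdeg]
  simp only [h]
  ring

/-- Interpolation at the n nodes reproduces the monomials of degree below n, so the two matrices
multiply to the Vandermonde matrix of u. -/
theorem det_lagrange_basis_mul {n : ℕ} {v : Fin n → F} (hv : Function.Injective v)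
    (u : Fin n → F) :
    (Matrix.of fun i j => (Lagrange.basis Finset.univ v j).eval (u i)).det *
      (Matrix.vandermonde v).det = (Matrix.vandermonde u).det := by
  rw [← Matrix.det_mul]
  congr 1
  ext i k
  have := eval_eq_sum_basis hv (f := X ^ (k : ℕ))
    (by rw [degree_X_pow]; exact_mod_cast k.2) (u i)
  simp only [eval_pow, eval_X] at this
  simp [Matrix.mul_apply, Matrix.vandermonde_apply, this, mul_comm]

/-- The Cauchy determinant. -/
theorem det_cauchy {n : ℕ} {u v : Fin n → F} (hv : Function.Injective v)
    (huv : ∀ i j, u i ≠ v j) :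
    (Matrix.of fun i j => 1 / (u i - v j)).det * ∏ i, ∏ j, (u i - v j) =
      (-1) ^ (n * (n - 1) / 2) * (Matrix.vandermonde u).det * (Matrix.vandermonde v).det := by
  have hv0 : (Matrix.vandermonde v).det ≠ 0 := Matrix.det_vandermonde_ne_zero_iff.2 hv
  -- Clearing denominators in a row leaves ∏_{l≠j} (u_i - v_l), a Lagrange basis polynomial up to a
  -- factor depending on j only.
  have hentry : ∀ i j, (∏ l, (u i - v l)) * (1 / (u i - v j)) =
      (∏ l ∈ Finset.univ.erase j, (v j - v l)) * (Lagrange.basis Finset.univ v j).eval (u i) := by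
    intro i j
    have h1 : u i - v j ≠ 0 := sub_ne_zero.2 (huv i j)
    rw [← Finset.mul_prod_erase _ _ (Finset.mem_univ j), Lagrange.basis, eval_prod,
      ← Finset.prod_mul_distrib, mul_comm (u i - v j), mul_assoc, mul_one_div_cancel h1, mul_one]
    refine Finset.prod_congr rfl fun l hl => ?_
    have h2 : v j - v l ≠ 0 := sub_ne_zero.2 fun h => Finset.ne_of_mem_erase hl (hv h).symm
    simp [Lagrange.basisDivisor, h2]
  rw [mul_comm, ← Matrix.det_mul_column]
  simp only [Matrix.of_apply, hentry]
  have := Matrix.det_mul_row (fun j => ∏ l ∈ Finset.univ.erase j, (v j - v l))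
    (Matrix.of fun i j => (Lagrange.basis Finset.univ v j).eval (u i))
  simp only [Matrix.of_apply] at this
  rw [this, prod_prod_erase_sub, ← det_lagrange_basis_mul hv u]
  ring

/-- The mixed Vandermonde-Cauchy determinant. -/
theorem det_fromBlocks_vandermonde_cauchy {n k : ℕ} (x : Fin n → F) {ε μ : Fin k → F}
    (hμ : Function.Injective μ) (hx : ∀ i a, x i ≠ ε a) (hεμ : ∀ j a, μ j ≠ ε a)
    {p : Fin n → F[X]} (hp : ∀ i, (p i).Monic) (hdeg : ∀ i, (p i).natDegree = i) :
    (Matrix.fromBlocks (Matrix.of fun l i => (p l).eval (x i))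
      (Matrix.of fun l j => (p l).eval (μ j))
      (Matrix.of fun a i => 1 / (x i - ε a))
      (Matrix.of fun a j => 1 / (μ j - ε a))).det =
    (Matrix.vandermonde x).det * (∏ j, ∏ i, (μ j - x i) / (ε j - x i)) *
      (Matrix.of fun a j => 1 / (μ j - ε a)).det := by
  set E : F[X] := Lagrange.nodal Finset.univ ε with hE
  set M : F[X] := Lagrange.nodal Finset.univ μ with hM
  have hEm : E.Monic := Lagrange.nodal_monic
  have hMm : M.Monic := Lagrange.nodal_monic
  have hEdeg : E.natDegree = k := by simp [hE]
  have hMdeg : M.natDegree = k := by simp [hM]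
  have hEx : ∀ i, E.eval (x i) ≠ 0 := fun i => by
    rw [hE, Lagrange.eval_nodal]
    exact Finset.prod_ne_zero_iff.2 fun a _ => sub_ne_zero.2 (hx i a)
  -- Coefficients of the column operation that clears the block `C`: they interpolate at the μ_j
  -- after multiplication by E, then divide by E(x_i).
  set c : Matrix (Fin k) (Fin n) F := Matrix.of fun j i =>
    (Lagrange.basis Finset.univ μ j).eval (x i) * E.eval (μ j) / E.eval (x i) with hc
  set q : Fin n → F[X] := fun l => (p l * E) /ₘ M with hq
  have hnd : ∀ l, (p l * E).natDegree = l + k := fun l => by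
    rw [(hp l).natDegree_mul hEm, hdeg, hEdeg]
  have hqdeg : ∀ l, (q l).natDegree = l := fun l => by
    rw [hq, natDegree_divByMonic _ hMm, hnd, hMdeg, Nat.add_sub_cancel]
  have hqm : ∀ l, (q l).Monic := fun l => by
    have : (q l).leadingCoeff = (p l * E).leadingCoeff := by
      refine leadingCoeff_divByMonic_of_monic hMm ?_
      rw [degree_eq_natDegree hMm.ne_zero, degree_eq_natDegree ((hp l).mul hEm).ne_zero,
        hnd, hMdeg]
      exact_mod_cast Nat.le_add_left _ _
    rw [Monic, this]
    exact (hp l).mul hEm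
  set A : Matrix (Fin n) (Fin n) F := Matrix.of fun l i => (p l).eval (x i)
  set B : Matrix (Fin n) (Fin k) F := Matrix.of fun l j => (p l).eval (μ j)
  set C : Matrix (Fin k) (Fin n) F := Matrix.of fun a i => 1 / (x i - ε a)
  set D : Matrix (Fin k) (Fin k) F := Matrix.of fun a j => 1 / (μ j - ε a)
  -- Subtracting the interpolant of p_l E leaves q_l M. Since q_l is again monic of degree l, the
  -- block is still a Vandermonde one, and M/E is the wanted ratio.
  have hAB : A - B * c = Matrix.of fun l i => (M.eval (x i) / E.eval (x i)) * (q l).eval (x i) := by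
    ext l i
    have h := eval_eq_divByMonic_nodal_add hμ (p l * E) (x i)
    rw [← hM] at h
    simp only [eval_mul] at h
    have h3 : (B * c) l i = (∑ j, (p l).eval (μ j) * E.eval (μ j) *
        (Lagrange.basis Finset.univ μ j).eval (x i)) / E.eval (x i) := by
      rw [Matrix.mul_apply, Finset.sum_div]
      refine Finset.sum_congr rfl fun j _ => ?_
      simp only [B, hc, Matrix.of_apply]
      ring
    rw [Matrix.sub_apply, h3]
    simp only [A, Matrix.of_apply, hq]
    have := hEx i
    field_simp
    linear_combination h
  -- E/(z - ε_a) is a polynomial of degree k - 1, so interpolation at the k points μ_j is exact.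
  have hCD : C - D * c = 0 := by
    ext a i
    have hEa : ∀ z, z ≠ ε a → (Lagrange.nodal (Finset.univ.erase a) ε).eval z =
        E.eval z * (1 / (z - ε a)) := fun z hz => by
      have : z - ε a ≠ 0 := sub_ne_zero.2 hz
      rw [hE, Lagrange.nodal_eq_mul_nodal_erase (Finset.mem_univ a)]
      simp only [eval_mul, eval_sub, eval_X, eval_C]
      field_simp
    have h := eval_eq_sum_basis hμ (f := Lagrange.nodal (Finset.univ.erase a) ε) (by
      rw [Lagrange.degree_nodal, Finset.card_erase_of_mem (Finset.mem_univ a), Finset.card_univ,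
        Fintype.card_fin]
      exact_mod_cast Nat.sub_lt (Fin.pos a) one_pos) (x i)
    rw [hEa _ (hx i a)] at h
    simp only [fun j => hEa _ (hεμ j a)] at h
    have h3 : (D * c) a i = (∑ j, E.eval (μ j) * (1 / (μ j - ε a)) *
        (Lagrange.basis Finset.univ μ j).eval (x i)) / E.eval (x i) := by
      rw [Matrix.mul_apply, Finset.sum_div]
      refine Finset.sum_congr rfl fun j _ => ?_
      simp only [D, hc, Matrix.of_apply]
      ring
    rw [Matrix.sub_apply, h3, ← h]
    simp only [C, Matrix.of_apply, Matrix.zero_apply]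
    rw [mul_div_cancel_left₀ _ (hEx i), sub_self]
  have hmul : Matrix.fromBlocks A B C D * Matrix.fromBlocks 1 0 (-c) 1 =
      Matrix.fromBlocks (A - B * c) B 0 D := by
    rw [Matrix.fromBlocks_multiply, ← hCD]
    simp [sub_eq_add_neg]
  have hdet := congrArg Matrix.det hmul
  rw [Matrix.det_mul, Matrix.det_fromBlocks_zero₁₂, Matrix.det_one, Matrix.det_one, one_mul,
    mul_one, Matrix.det_fromBlocks_zero₂₁, hAB] at hdet
  rw [hdet]
  congr 1
  have h4 := Matrix.det_mul_row (fun i => M.eval (x i) / E.eval (x i))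
    (Matrix.of fun l i => (q l).eval (x i))
  simp only [Matrix.of_apply] at h4
  rw [h4, Matrix.det_eval_matrixOfPolynomials_eq_det_vandermonde x q hqdeg hqm,
    ← Matrix.det_transpose (Matrix.of fun l i => (q l).eval (x i)), mul_comm, Finset.prod_comm]
  congr 1
  refine Finset.prod_congr rfl fun i _ => ?_
  rw [hM, hE, Lagrange.eval_nodal, Lagrange.eval_nodal, ← Finset.prod_div_distrib]
  refine Finset.prod_congr rfl fun j _ => ?_
  rw [← neg_sub (x i) (μ j), ← neg_sub (x i) (ε j), neg_div_neg_eq]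

end Determinants

/-! ### Andréief's identity with constant columns -/

section Andreief

/-- The square matrix with columns `a · i` followed by columns `b · j`. -/
def borderedMatrix {n k : ℕ} (a : Fin n ⊕ Fin k → Fin n → ℂ) (b : Fin n ⊕ Fin k → Fin k → ℂ) :
    Matrix (Fin n ⊕ Fin k) (Fin n ⊕ Fin k) ℂ :=
  Matrix.of fun r c => Sum.elim (a r) (b r) c

theorem det_borderedMatrix_perm {n k : ℕ} (a : Fin n ⊕ Fin k → Fin n → ℂ)
    (b : Fin n ⊕ Fin k → Fin k → ℂ) (σ : Equiv.Perm (Fin n)) :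
    (borderedMatrix (fun r i => a r (σ i)) b).det =
      (Equiv.Perm.sign σ : ℤ) * (borderedMatrix a b).det := by
  have h : borderedMatrix (fun r i => a r (σ i)) b =
      (borderedMatrix a b).submatrix id (Equiv.Perm.sumCongr σ (1 : Equiv.Perm (Fin k))) := by
    ext r c
    rcases c with i | j <;> simp [borderedMatrix]
  rw [h, Matrix.det_permute', Equiv.Perm.sign_sumCongr, Equiv.Perm.sign_one, mul_one]

/-- In the Leibniz expansion x_i enters through column i alone, so every term is a product of
functions of one variable and Fubini applies. -/
theorem integrable_integral_prod_mul_det {n k : ℕ} (f : Fin n → ℝ → ℂ)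
    (g : Fin n ⊕ Fin k → ℝ → ℂ) (b : Fin n ⊕ Fin k → Fin k → ℂ)
    (hfg : ∀ i r, Integrable fun t => f i t * g r t) :
    Integrable (fun x : Fin n → ℝ =>
      (∏ i, f i (x i)) * (borderedMatrix (fun r i => g r (x i)) b).det) ∧
    ∫ x : Fin n → ℝ, (∏ i, f i (x i)) * (borderedMatrix (fun r i => g r (x i)) b).det =
      (borderedMatrix (fun r i => ∫ t, f i t * g r t) b).det := by
  have hexp : (fun x : Fin n → ℝ =>
      (∏ i, f i (x i)) * (borderedMatrix (fun r i => g r (x i)) b).det) =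
      fun x => ∑ τ : Equiv.Perm (Fin n ⊕ Fin k),
        (((Equiv.Perm.sign τ : ℤ) : ℂ) * ∏ j, b (τ (Sum.inr j)) j) *
          ∏ i, (f i (x i) * g (τ (Sum.inl i)) (x i)) := by
    funext x
    rw [Matrix.det_apply', Finset.mul_sum]
    refine Finset.sum_congr rfl fun τ _ => ?_
    simp only [borderedMatrix, Matrix.of_apply, Fintype.prod_sum_type, Sum.elim_inl, Sum.elim_inr,
      Finset.prod_mul_distrib]
    ring
  have hint : ∀ τ : Equiv.Perm (Fin n ⊕ Fin k), Integrable (fun x : Fin n → ℝ =>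
      (((Equiv.Perm.sign τ : ℤ) : ℂ) * ∏ j, b (τ (Sum.inr j)) j) *
          ∏ i, (f i (x i) * g (τ (Sum.inl i)) (x i))) := fun τ =>
    (Integrable.fintype_prod (f := fun i t => f i t * g (τ (Sum.inl i)) t)
      fun i => hfg i _).const_mul _
  rw [hexp]
  refine ⟨integrable_finsetSum _ fun τ _ => hint τ, ?_⟩
  rw [integral_finsetSum _ fun τ _ => hint τ, Matrix.det_apply']
  refine Finset.sum_congr rfl fun τ _ => ?_
  rw [integral_const_mul,
    integral_fintype_prod_volume_eq_prod (f := fun i t => f i t * g (τ (Sum.inl i)) t)]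
  simp only [borderedMatrix, Matrix.of_apply, Fintype.prod_sum_type, Sum.elim_inl, Sum.elim_inr]
  ring

/-- Andréief's identity for a determinant bordered by constant columns. -/
theorem integrable_integral_det_mul_det {n k : ℕ} (w : ℝ → ℂ) (f : Fin n → ℝ → ℂ)
    (g : Fin n ⊕ Fin k → ℝ → ℂ) (b : Fin n ⊕ Fin k → Fin k → ℂ)
    (hfg : ∀ i r, Integrable fun t => w t * f i t * g r t) :
    Integrable (fun x : Fin n → ℝ => (∏ i, w (x i)) * (Matrix.of fun l i => f l (x i)).det *
      (borderedMatrix (fun r i => g r (x i)) b).det) ∧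
    ∫ x : Fin n → ℝ, (∏ i, w (x i)) * (Matrix.of fun l i => f l (x i)).det *
      (borderedMatrix (fun r i => g r (x i)) b).det =
      n.factorial * (borderedMatrix (fun r i => ∫ t, w t * f i t * g r t) b).det := by
  have hexp : (fun x : Fin n → ℝ => (∏ i, w (x i)) * (Matrix.of fun l i => f l (x i)).det *
      (borderedMatrix (fun r i => g r (x i)) b).det) =
      fun x => ∑ σ : Equiv.Perm (Fin n), ((Equiv.Perm.sign σ : ℤ) : ℂ) *
        ((∏ i, (w (x i) * f (σ i) (x i))) * (borderedMatrix (fun r i => g r (x i)) b).det) := by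
    funext x
    rw [Matrix.det_apply', Finset.mul_sum, Finset.sum_mul]
    refine Finset.sum_congr rfl fun σ _ => ?_
    simp only [Matrix.of_apply, Finset.prod_mul_distrib]
    ring
  have key := fun σ : Equiv.Perm (Fin n) =>
    integrable_integral_prod_mul_det (fun i t => w t * f (σ i) t) g b fun i r => hfg (σ i) r
  rw [hexp]
  refine ⟨integrable_finsetSum _ fun σ _ => (key σ).1.const_mul _, ?_⟩
  rw [integral_finsetSum _ fun σ _ => (key σ).1.const_mul _]
  -- Integration leaves the first n columns permuted by σ. The resulting sign cancels the Leibniz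
  -- sign, so all n! terms are equal.
  have hterm : ∀ σ : Equiv.Perm (Fin n), ∫ x : Fin n → ℝ, ((Equiv.Perm.sign σ : ℤ) : ℂ) *
      ((∏ i, (w (x i) * f (σ i) (x i))) * (borderedMatrix (fun r i => g r (x i)) b).det) =
      (borderedMatrix (fun r i => ∫ t, w t * f i t * g r t) b).det := by
    intro σ
    rw [integral_const_mul, (key σ).2,
      det_borderedMatrix_perm (fun r i => ∫ t, w t * f i t * g r t) b σ, ← mul_assoc,
      ← Int.cast_mul, ← Units.val_mul, Int.units_mul_self]
    simp
  simp only [hterm]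
  simp [Fintype.card_perm]

end Andreief

/-! ### Three-term recurrence of the orthogonal polynomials -/

section Recurrence

variable {V : ℝ → ℝ} {N : ℕ}

theorem pairing_C_mul_left (a : ℝ) (p q : ℝ[X]) :
    pairing V N (C a * p) q = a * pairing V N p q := by
  unfold pairing
  rw [← integral_const_mul]
  simp [mul_assoc]

theorem pairing_X_mul_left (p q : ℝ[X]) : pairing V N (X * p) q = pairing V N p (X * q) := by
  unfold pairing
  congr 1
  funext x
  simp only [eval_mul, eval_X]
  ring

theorem pairing_monicOrthPoly_of_ne (hV : FiniteMoments V N) {k m : ℕ} (h : k ≠ m) :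
    pairing V N (monicOrthPoly V N k) (monicOrthPoly V N m) = 0 :=
  (monicOrthPoly_spec hV).2.1 k m h

theorem monicOrthPoly_zero : monicOrthPoly V N 0 = 1 := by
  rw [monicOrthPoly]; simp

theorem degree_monicOrthPoly (k : ℕ) : (monicOrthPoly V N k).degree = k := by
  rw [degree_eq_natDegree (monicOrthPoly_monic_natDegree k).1.ne_zero,
    (monicOrthPoly_monic_natDegree k).2]

/-- The monic π_j with j < m span the polynomials of degree below m: subtracting the top coefficient
times π_m lowers the degree. -/
theorem pairing_eq_zero_of_degree_lt (hV : FiniteMoments V N) {r : ℝ[X]} {m : ℕ}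
    (hr : ∀ j < m, pairing V N (monicOrthPoly V N j) r = 0) {q : ℝ[X]} (hq : q.degree < m) :
    pairing V N q r = 0 := by
  induction m generalizing q with
  | zero =>
    have : q = 0 := by simpa using hq
    simp [this, pairing]
  | succ m ih =>
    have hdeg : (q - C (q.coeff m) * monicOrthPoly V N m).degree < m := by
      rw [degree_lt_iff_coeff_zero]
      intro j hj
      rw [coeff_sub, coeff_C_mul]
      rcases hj.eq_or_lt with rfl | hj
      · have := (monicOrthPoly_monic_natDegree (V := V) (N := N) m).1.coeff_natDegree
        rw [(monicOrthPoly_monic_natDegree m).2] at this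
        rw [this, mul_one, sub_self]
      · rw [coeff_eq_zero_of_degree_lt (hq.trans_le (by exact_mod_cast hj)),
          coeff_eq_zero_of_degree_lt (p := monicOrthPoly V N m) (by rw [degree_monicOrthPoly]; exact_mod_cast hj),
          mul_zero, sub_zero]
    have h := ih (fun j hj => hr j (hj.trans m.lt_succ_self)) hdeg
    rwa [pairing_sub_left hV, pairing_C_mul_left, hr m m.lt_succ_self, mul_zero, sub_zero] at h

theorem pairing_monicOrthPoly_right_eq_zero (hV : FiniteMoments V N) {q : ℝ[X]} {m : ℕ}
    (hq : q.degree < m) : pairing V N q (monicOrthPoly V N m) = 0 :=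
  pairing_eq_zero_of_degree_lt hV (fun _ hj => pairing_monicOrthPoly_of_ne hV hj.ne) hq

theorem eq_zero_of_pairing_eq_zero (hV : FiniteMoments V N) {r : ℝ[X]} {m : ℕ}
    (hr : ∀ j < m, pairing V N (monicOrthPoly V N j) r = 0) (hdeg : r.degree < m) : r = 0 := by
  by_contra h
  exact (pairing_self_pos hV h).ne' (pairing_eq_zero_of_degree_lt hV hr hdeg)

theorem degree_X_mul_monicOrthPoly_sub_lt (k : ℕ) :
    (X * monicOrthPoly V N k - monicOrthPoly V N (k + 1)).degree < ((k + 1 : ℕ) : WithBot ℕ) := by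
  have hd : (X * monicOrthPoly V N k).degree = ((k + 1 : ℕ) : WithBot ℕ) := by
    rw [degree_mul, degree_X, degree_monicOrthPoly]
    push_cast
    ring
  refine (degree_sub_lt_left (by rw [hd, degree_monicOrthPoly]) ?_ ?_).trans_eq hd
  · exact (monic_X.mul (monicOrthPoly_monic_natDegree k).1).ne_zero
  · rw [(monic_X.mul (monicOrthPoly_monic_natDegree k).1).leadingCoeff,
      (monicOrthPoly_monic_natDegree (k + 1)).1.leadingCoeff]

theorem pairing_X_mul_monicOrthPoly_succ (hV : FiniteMoments V N) (k : ℕ) :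
    pairing V N (X * monicOrthPoly V N k) (monicOrthPoly V N (k + 1)) = normSq V N (k + 1) := by
  have h := pairing_monicOrthPoly_right_eq_zero hV
    (degree_X_mul_monicOrthPoly_sub_lt (V := V) (N := N) k)
  rw [pairing_sub_left hV, sub_eq_zero] at h
  exact h

/-- The recurrence for `π_1`. -/
theorem X_mul_monicOrthPoly_zero :
    ∃ a : ℝ, X * monicOrthPoly V N 0 = monicOrthPoly V N 1 + C a * monicOrthPoly V N 0 := by
  have hdeg := degree_X_mul_monicOrthPoly_sub_lt (V := V) (N := N) 0
  refine ⟨(X * monicOrthPoly V N 0 - monicOrthPoly V N 1).coeff 0, ?_⟩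
  rw [zero_add] at hdeg
  have h := eq_C_of_degree_le_zero (p := X * monicOrthPoly V N 0 - monicOrthPoly V N 1)
    ((degree_le_iff_coeff_zero _ _).2 fun j hj => coeff_eq_zero_of_degree_lt
      (hdeg.trans_le (by exact_mod_cast Nat.one_le_cast.2 (by exact_mod_cast hj))))
  rw [sub_eq_iff_eq_add] at h
  rw [h, monicOrthPoly_zero]
  simp [add_comm]

/-- The three-term recurrence of the monic orthogonal polynomials. -/
theorem X_mul_monicOrthPoly_succ (hV : FiniteMoments V N) (k : ℕ) :
    ∃ a : ℝ, X * monicOrthPoly V N (k + 1) = monicOrthPoly V N (k + 2) +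
      C a * monicOrthPoly V N (k + 1) +
      C (normSq V N (k + 1) / normSq V N k) * monicOrthPoly V N k := by
  set p := monicOrthPoly V N with hp
  have hpos := (monicOrthPoly_spec hV).2.2
  set a := pairing V N (X * p (k + 1)) (p (k + 1)) / normSq V N (k + 1) with ha
  set b := normSq V N (k + 1) / normSq V N k with hb
  refine ⟨a, ?_⟩
  -- The residual has degree below k + 2 and is orthogonal to π_0, …, π_{k+1}. For j < k this holds
  -- because X π_j has degree below k + 1.
  have hzero : X * p (k + 1) - p (k + 2) - C a * p (k + 1) - C b * p k = 0 := by
    refine eq_zero_of_pairing_eq_zero hV (m := k + 2) ?_ ?_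
    · intro j hj
      rw [pairing_comm, pairing_sub_left hV, pairing_sub_left hV, pairing_sub_left hV,
        pairing_C_mul_left, pairing_C_mul_left,
        pairing_monicOrthPoly_of_ne hV (show k + 2 ≠ j by omega)]
      rcases Nat.lt_succ_iff_lt_or_eq.1 hj with hj | rfl
      · rw [pairing_monicOrthPoly_of_ne hV (show k + 1 ≠ j by omega)]
        rcases Nat.lt_succ_iff_lt_or_eq.1 hj with hj | rfl
        · rw [pairing_monicOrthPoly_of_ne hV (show k ≠ j by omega), pairing_X_mul_left,
            pairing_comm, pairing_monicOrthPoly_right_eq_zero hV]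
          · ring
          · rw [degree_mul, degree_X, degree_monicOrthPoly]
            exact_mod_cast (by omega : 1 + j < k + 1)
        · rw [pairing_X_mul_left, pairing_comm, pairing_X_mul_monicOrthPoly_succ hV]
          change _ - _ - _ - b * normSq V N j = 0
          rw [hb, div_mul_cancel₀ _ (hpos j).ne']
          ring
      · rw [pairing_monicOrthPoly_of_ne hV (show k ≠ k + 1 by omega)]
        change _ - _ - a * normSq V N (k + 1) - _ = 0
        rw [ha, div_mul_cancel₀ _ (hpos (k + 1)).ne']
        ring
    · have h1 := degree_X_mul_monicOrthPoly_sub_lt (V := V) (N := N) (k + 1)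
      have h2 : ∀ (c : ℝ) (j : ℕ), j < k + 2 → (C c * p j).degree < ((k + 2 : ℕ) : WithBot ℕ) := by
        intro c j hj
        rw [← smul_eq_C_mul]
        refine (degree_smul_le _ _).trans_lt ?_
        rw [degree_monicOrthPoly]
        exact_mod_cast hj
      exact (degree_sub_le _ _).trans_lt (max_lt ((degree_sub_le _ _).trans_lt
        (max_lt h1 (h2 _ _ (by omega)))) (h2 _ _ (by omega)))
  linear_combination hzero

end Recurrence

/-! ### Cauchy transforms and the Christoffel-Darboux formula -/

section CauchyTransform

variable {V : ℝ → ℝ} {N : ℕ}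

theorem integrable_weight_mul_eval_div (hV : FiniteMoments V N) (p : ℝ[X]) {z : ℂ}
    (hz : z.im ≠ 0) :
    Integrable fun x : ℝ => ((weight V N x * p.eval x : ℝ) : ℂ) / ((x : ℂ) - z) := by
  have h1 : Integrable fun x : ℝ => ((weight V N x * p.eval x : ℝ) : ℂ) := by
    simpa [mul_comm] using (hV.integrable_poly p).ofReal (𝕜 := ℂ)
  simp only [div_eq_mul_inv]
  refine h1.mul_bdd (c := |z.im|⁻¹) ?_ (Filter.Eventually.of_forall fun x => ?_)
  · have : Measurable fun x : ℝ => ((x : ℂ) - z)⁻¹ := by fun_prop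
    exact this.aestronglyMeasurable
  · rw [norm_inv]
    refine inv_anti₀ (abs_pos.2 hz) ?_
    have := Complex.abs_im_le_norm ((x : ℂ) - z)
    simpa using this

/-- `∫ exp (-N V(x)) p(x) / (x - z) dx`. -/
def weightedCauchy (V : ℝ → ℝ) (N : ℕ) (z : ℂ) (p : ℝ[X]) : ℂ :=
  ∫ x : ℝ, ((weight V N x * p.eval x : ℝ) : ℂ) / ((x : ℂ) - z)

theorem weightedCauchy_add (hV : FiniteMoments V N) {z : ℂ} (hz : z.im ≠ 0) (p q : ℝ[X]) :
    weightedCauchy V N z (p + q) = weightedCauchy V N z p + weightedCauchy V N z q := by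
  unfold weightedCauchy
  rw [← integral_add (integrable_weight_mul_eval_div hV p hz)
    (integrable_weight_mul_eval_div hV q hz)]
  congr 1
  funext x
  simp only [eval_add]
  push_cast
  ring

theorem weightedCauchy_C_mul {z : ℂ} (a : ℝ) (p : ℝ[X]) :
    weightedCauchy V N z (C a * p) = a * weightedCauchy V N z p := by
  unfold weightedCauchy
  rw [← integral_const_mul]
  congr 1
  funext x
  simp only [eval_mul, eval_C]
  push_cast
  ring

/-- From x/(x - z) = 1 + z/(x - z). The Cauchy transforms thus inherit the recurrence of the π_k, up
to a pairing with 1. -/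
theorem weightedCauchy_X_mul (hV : FiniteMoments V N) {z : ℂ} (hz : z.im ≠ 0) (p : ℝ[X]) :
    weightedCauchy V N z (X * p) = z * weightedCauchy V N z p + (pairing V N p 1 : ℂ) := by
  have h1 : Integrable fun x : ℝ => ((p.eval x * (1 : ℝ[X]).eval x * weight V N x : ℝ) : ℂ) :=
    (hV.integrable_mul p 1).ofReal
  unfold weightedCauchy pairing
  rw [← integral_const_mul, ← integral_complex_ofReal,
    ← integral_add ((integrable_weight_mul_eval_div hV p hz).const_mul z) h1]
  congr 1
  funext x
  have hx : (x : ℂ) - z ≠ 0 := fun h => hz (by simpa using congrArg Complex.im h)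
  simp only [eval_mul, eval_X, eval_one]
  push_cast
  field_simp
  ring

theorem cauchyTransform_eq (k : ℕ) (z : ℂ) : cauchyTransform V N k z =
    1 / (2 * (Real.pi : ℂ) * Complex.I) * weightedCauchy V N z (monicOrthPoly V N k) := rfl

/-- A Christoffel-Darboux formula with one family replaced by its Cauchy transforms. -/
theorem sum_weightedCauchy_mul_orthEval (hV : FiniteMoments V N) {z : ℂ} (hz : z.im ≠ 0) (m : ℂ)
    (n : ℕ) :
    (z - m) * ∑ k ∈ Finset.range (n + 1),
      weightedCauchy V N z (monicOrthPoly V N k) * orthEval V N k m / (normSq V N k : ℂ) =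
    (weightedCauchy V N z (monicOrthPoly V N (n + 1)) * orthEval V N n m -
      weightedCauchy V N z (monicOrthPoly V N n) * orthEval V N (n + 1) m) /
        (normSq V N n : ℂ) - 1 := by
  have hne : ∀ k, (normSq V N k : ℂ) ≠ 0 := fun k =>
    Complex.ofReal_ne_zero.2 ((monicOrthPoly_spec hV).2.2 k).ne'
  induction n with
  | zero =>
    obtain ⟨a, ha⟩ := X_mul_monicOrthPoly_zero (V := V) (N := N)
    have h1 := congrArg (weightedCauchy V N z) ha
    have h2 := congrArg (aeval m) ha
    rw [weightedCauchy_X_mul hV hz, weightedCauchy_add hV hz, weightedCauchy_C_mul] at h1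
    -- Only at index 0 is the pairing with 1 = π_0 nonzero; divided by c_0² it produces the term -1.
    have h3 : (pairing V N (monicOrthPoly V N 0) 1 : ℂ) = normSq V N 0 := by
      rw [normSq, monicOrthPoly_zero]
    rw [h3] at h1
    simp only [map_mul, map_add, aeval_X, aeval_C, Complex.coe_algebraMap] at h2
    have := hne 0
    simp only [zero_add, Finset.sum_range_one, orthEval]
    have h0 : aeval m (monicOrthPoly V N 0) = 1 := by rw [monicOrthPoly_zero, map_one]
    rw [h0] at h2 ⊢
    field_simp
    linear_combination h1 - weightedCauchy V N z (monicOrthPoly V N 0) * h2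
  | succ n ih =>
    obtain ⟨a, ha⟩ := X_mul_monicOrthPoly_succ hV n
    have h1 := congrArg (weightedCauchy V N z) ha
    have h2 := congrArg (aeval m) ha
    rw [weightedCauchy_X_mul hV hz, weightedCauchy_add hV hz, weightedCauchy_add hV hz,
      weightedCauchy_C_mul, weightedCauchy_C_mul] at h1
    have h3 : pairing V N (monicOrthPoly V N (n + 1)) 1 = 0 := by
      rw [← monicOrthPoly_zero (V := V) (N := N)]
      exact pairing_monicOrthPoly_of_ne hV (Nat.succ_ne_zero n)
    rw [h3] at h1
    simp only [map_mul, map_add, aeval_X, aeval_C, Complex.coe_algebraMap] at h2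
    rw [Finset.sum_range_succ, mul_add, ih]
    have := hne n
    have := hne (n + 1)
    simp only [orthEval] at *
    push_cast at h1 h2
    field_simp at h1 h2 ⊢
    -- Cross-multiplying the two recurrences eliminates `a`, and the coefficient c_{n+1}²/c_n²
    -- matches the boundary terms at n and n + 1, so the sum telescopes.
    linear_combination aeval m (monicOrthPoly V N (n + 1)) * h1 -
      weightedCauchy V N z (monicOrthPoly V N (n + 1)) * h2

/-- The -1 in the Christoffel-Darboux formula, divided by z - m, cancels 1/(m - z). The 2πi in
γ_{N-1} undoes the normalization of h_k. -/
theorem gammaCoeff_mul_kernelII (hV : FiniteMoments V N) (hN : 1 ≤ N) {z m : ℂ} (hz : z.im ≠ 0)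
    (hzm : z ≠ m) :
    1 / (m - z) - ∑ k : Fin N,
      weightedCauchy V N z (monicOrthPoly V N k) * orthEval V N k m / (normSq V N k : ℂ) =
    gammaCoeff V N (N - 1) * kernelII V N z m := by
  obtain ⟨n, hn⟩ := Nat.exists_eq_add_of_le' hN
  have h := sum_weightedCauchy_mul_orthEval hV hz m n
  rw [Fin.sum_univ_eq_sum_range (fun k =>
    weightedCauchy V N z (monicOrthPoly V N k) * orthEval V N k m / (normSq V N k : ℂ)) N]
  rw [← hn] at h
  rw [kernelII, cauchyTransform_eq, cauchyTransform_eq, gammaCoeff,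
    show N - 1 = n by omega]
  have h1 : z - m ≠ 0 := sub_ne_zero.2 hzm
  have h2 : m - z ≠ 0 := sub_ne_zero.2 hzm.symm
  have h3 : (normSq V N n : ℂ) ≠ 0 :=
    Complex.ofReal_ne_zero.2 ((monicOrthPoly_spec hV).2.2 n).ne'
  have h4 : 2 * (Real.pi : ℂ) * Complex.I ≠ 0 := Complex.two_pi_I_ne_zero
  rw [mul_comm, ← eq_div_iff h1] at h
  rw [h, ← neg_sub z m]
  field_simp
  ring

end CauchyTransform

/-! ### The ensemble average as a K×K determinant -/

section Ensemble

variable {V : ℝ → ℝ} {N : ℕ}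

theorem charRatio_diagonal {K : ℕ} (ε μ : Fin K → ℂ) (x : Fin N → ℂ) :
    charRatio ε μ (Matrix.diagonal x) = ∏ j, ∏ i, (μ j - x i) / (ε j - x i) := by
  have h : ∀ z : ℂ, charDet z (Matrix.diagonal x) = ∏ i, (z - x i) := by
    intro z
    rw [charDet, ← Matrix.det_diagonal]
    congr 1
    ext i j
    by_cases hij : i = j <;> simp [hij]
  simp only [charRatio, h, Finset.prod_div_distrib]

theorem unnormalizedDensity_eq (x : Fin N → ℝ) :
    (unnormalizedDensity V N x : ℂ) = (∏ i, (weight V N (x i) : ℂ)) *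
      (Matrix.vandermonde fun i => (x i : ℂ)).det ^ 2 := by
  have h1 : ((vdet x : ℝ) : ℂ) = (Matrix.vandermonde fun i => (x i : ℂ)).det := by
    simp only [vdet, Matrix.det_vandermonde]
    push_cast
    rfl
  simp only [unnormalizedDensity, Finset.mul_sum, Real.exp_sum, ← h1, weight]
  push_cast
  rfl

/-- The rows `π_l(t)` and `1 / (t - ε_a)` of the mixed Vandermonde-Cauchy determinant. -/
def mixedRow (V : ℝ → ℝ) (N : ℕ) {K : ℕ} (ε : Fin K → ℂ) (r : Fin N ⊕ Fin K) (z : ℂ) : ℂ :=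
  Sum.elim (fun l : Fin N => orthEval V N l z) (fun a => 1 / (z - ε a)) r

theorem orthEval_ofReal (k : ℕ) (x : ℝ) :
    orthEval V N k (x : ℂ) = (((monicOrthPoly V N k).eval x : ℝ) : ℂ) := by
  rw [orthEval, ← Complex.coe_algebraMap, aeval_algebraMap_apply, coe_aeval_eq_eval]

theorem ofReal_ne_of_im_ne_zero {z : ℂ} (hz : z.im ≠ 0) (x : ℝ) : (x : ℂ) ≠ z := by
  rintro rfl
  simp at hz

theorem unnormalizedDensity_mul_charRatio {K : ℕ} {ε μ : Fin K → ℂ}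
    (hε_im : ∀ j, (ε j).im ≠ 0) (hμ : Function.Injective μ) (hεμ : ∀ i j, ε i ≠ μ j)
    (x : Fin N → ℝ) :
    (unnormalizedDensity V N x : ℂ) * charRatio ε μ (Matrix.diagonal fun i => (x i : ℂ)) *
      (Matrix.of fun a j => 1 / (μ j - ε a)).det =
    (∏ i, (weight V N (x i) : ℂ)) * (Matrix.of fun l i : Fin N => orthEval V N l (x i)).det *
      (borderedMatrix (fun r i => mixedRow V N ε r (x i)) fun r j => mixedRow V N ε r (μ j)).det
      := by
  set p : Fin N → ℂ[X] := fun l => (monicOrthPoly V N l).map (algebraMap ℝ ℂ)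
  have hpm : ∀ l, (p l).Monic := fun l => (monicOrthPoly_monic_natDegree l).1.map _
  have hpd : ∀ l, (p l).natDegree = l := fun l => by
    rw [(monicOrthPoly_monic_natDegree (l : ℕ)).1.natDegree_map,
      (monicOrthPoly_monic_natDegree l).2]
  have hmat : borderedMatrix (fun r i => mixedRow V N ε r (x i))
      (fun r j => mixedRow V N ε r (μ j)) = Matrix.fromBlocks
      (Matrix.of fun l i => (p l).eval (x i : ℂ)) (Matrix.of fun l j => (p l).eval (μ j))
      (Matrix.of fun a i => 1 / ((x i : ℂ) - ε a)) (Matrix.of fun a j => 1 / (μ j - ε a)) := by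
    ext r c
    rcases r with l | a <;> rcases c with i | j <;>
      simp [borderedMatrix, mixedRow, p, orthEval]
  have hv : (Matrix.of fun l i : Fin N => orthEval V N l (x i)).det =
      (Matrix.vandermonde fun i => (x i : ℂ)).det := by
    rw [Matrix.det_eval_matrixOfPolynomials_eq_det_vandermonde _ p hpd hpm, ← Matrix.det_transpose]
    congr 1
    ext i l
    simp [p, orthEval]
  rw [hmat, det_fromBlocks_vandermonde_cauchy (fun i => (x i : ℂ)) hμ
    (fun i a => ofReal_ne_of_im_ne_zero (hε_im a) _) (fun j a => (hεμ a j).symm) hpm hpd, hv,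
    unnormalizedDensity_eq, charRatio_diagonal]
  ring

theorem integral_weight_mul_mixedRow (hV : FiniteMoments V N) {K : ℕ} {ε : Fin K → ℂ}
    (hε_im : ∀ j, (ε j).im ≠ 0) (i : Fin N) (r : Fin N ⊕ Fin K) :
    Integrable (fun t : ℝ => (weight V N t : ℂ) * orthEval V N i t * mixedRow V N ε r t) ∧
    ∫ t : ℝ, (weight V N t : ℂ) * orthEval V N i t * mixedRow V N ε r t =
      Sum.elim (fun l : Fin N => if l = i then (normSq V N i : ℂ) else 0)
        (fun a => weightedCauchy V N (ε a) (monicOrthPoly V N i)) r := by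
  rcases r with l | a
  · have h : (fun t : ℝ => (weight V N t : ℂ) * orthEval V N i t *
        mixedRow V N ε (Sum.inl l) t) = fun t : ℝ => (((monicOrthPoly V N l).eval t *
          (monicOrthPoly V N i).eval t * weight V N t : ℝ) : ℂ) := by
      funext t
      simp only [mixedRow, Sum.elim_inl, orthEval_ofReal]
      push_cast
      ring
    rw [h]
    refine ⟨(hV.integrable_mul _ _).ofReal, ?_⟩
    rw [integral_complex_ofReal, Sum.elim_inl]
    split_ifs with hli
    · rw [hli]; rfl
    · have := pairing_monicOrthPoly_of_ne hV (fun h => hli (Fin.ext h))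
      rw [pairing] at this
      rw [this, Complex.ofReal_zero]
  · have h : (fun t : ℝ => (weight V N t : ℂ) * orthEval V N i t *
        mixedRow V N ε (Sum.inr a) t) = fun t : ℝ =>
          ((weight V N t * (monicOrthPoly V N i).eval t : ℝ) : ℂ) / ((t : ℂ) - ε a) := by
      funext t
      simp only [mixedRow, Sum.elim_inr, orthEval_ofReal]
      push_cast
      ring
    rw [h]
    exact ⟨integrable_weight_mul_eval_div hV _ (hε_im a), rfl⟩

/-- Schur complement of the invertible diagonal block to which orthogonality reduces the integrated
π-rows. -/
theorem det_borderedMatrix_eq_det_schur {n k : ℕ} {d : Fin n → ℂ} (hd : ∀ i, d i ≠ 0)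
    (h : Fin k → Fin n → ℂ) (B : Fin n → Fin k → ℂ) (D : Fin k → Fin k → ℂ) :
    (borderedMatrix (fun r i => Sum.elim (fun l => if l = i then d i else 0) (fun a => h a i) r)
      (fun r j => Sum.elim (fun l => B l j) (fun a => D a j) r)).det =
    (∏ i, d i) * (Matrix.of fun a j => D a j - ∑ l, h a l * B l j / d l).det := by
  have hmat : borderedMatrix
      (fun r i => Sum.elim (fun l => if l = i then d i else 0) (fun a => h a i) r)
      (fun r j => Sum.elim (fun l => B l j) (fun a => D a j) r) =
      Matrix.fromBlocks (Matrix.diagonal d) (Matrix.of B) (Matrix.of h) (Matrix.of D) := by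
    ext r c
    rcases r with l | a <;> rcases c with i | j <;> simp [borderedMatrix, Matrix.diagonal_apply]
    exact ite_congr rfl (fun hli => by rw [hli]) fun _ => rfl
  let A' : Matrix (Fin n) (Fin n) ℂ := Matrix.diagonal fun i => (d i)⁻¹
  have hA' : A' * Matrix.diagonal d = 1 := by simp [A', hd]
  let _ : Invertible (Matrix.diagonal d) := ⟨A', hA', mul_eq_one_comm.1 hA'⟩
  rw [hmat, Matrix.det_fromBlocks₁₁, Matrix.det_diagonal]
  congr 2
  ext a j
  change D a j - (Matrix.of h * A' * Matrix.of B) a j = _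
  rw [Matrix.mul_apply]
  simp only [A', Matrix.mul_diagonal, Matrix.of_apply]
  congr 1
  refine Finset.sum_congr rfl fun l _ => ?_
  ring

/-- The unnormalised average of the product of ratios, times a Cauchy determinant. -/
theorem integrable_integral_unnormalized (hV : FiniteMoments V N) {K : ℕ} {ε μ : Fin K → ℂ}
    (hε_im : ∀ j, (ε j).im ≠ 0) (hμ : Function.Injective μ) (hεμ : ∀ i j, ε i ≠ μ j) :
    Integrable (fun x : Fin N → ℝ => (unnormalizedDensity V N x : ℂ) *
      charRatio ε μ (Matrix.diagonal fun i => (x i : ℂ)) *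
      (Matrix.of fun a j => 1 / (μ j - ε a)).det) ∧
    ∫ x : Fin N → ℝ, (unnormalizedDensity V N x : ℂ) *
      charRatio ε μ (Matrix.diagonal fun i => (x i : ℂ)) *
      (Matrix.of fun a j => 1 / (μ j - ε a)).det =
    N.factorial * (∏ i : Fin N, (normSq V N i : ℂ)) *
      (Matrix.of fun a j : Fin K => 1 / (μ j - ε a) - ∑ l : Fin N,
        weightedCauchy V N (ε a) (monicOrthPoly V N l) * orthEval V N l (μ j) /
          (normSq V N l : ℂ)).det := by
  simp only [unnormalizedDensity_mul_charRatio hε_im hμ hεμ]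
  have key := integral_weight_mul_mixedRow hV hε_im
  have h := integrable_integral_det_mul_det (fun t => (weight V N t : ℂ))
    (fun i t => orthEval V N (i : Fin N) t) (fun r t => mixedRow V N ε r t)
    (fun r j => mixedRow V N ε r (μ j)) fun i r => (key i r).1
  refine ⟨h.1, h.2.trans ?_⟩
  simp only [fun r i => (key i r).2]
  rw [mul_assoc]
  congr 1
  exact det_borderedMatrix_eq_det_schur
    (fun i => Complex.ofReal_ne_zero.2 ((monicOrthPoly_spec hV).2.2 i).ne') _ _ _

theorem partitionFunction_eq (hV : FiniteMoments V N) :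
    (partitionFunction V N : ℂ) = N.factorial * ∏ i : Fin N, (normSq V N i : ℂ) := by
  -- With K = 0 the ratio and both K×K determinants equal 1.
  have h := (integrable_integral_unnormalized hV (ε := Fin.elim0) (μ := Fin.elim0)
    (fun j => j.elim0) (fun j => j.elim0) (fun j => j.elim0)).2
  rw [partitionFunction, ← integral_complex_ofReal]
  simpa [charRatio] using h

theorem partitionFunction_ne_zero (hV : FiniteMoments V N) : (partitionFunction V N : ℂ) ≠ 0 := by
  rw [partitionFunction_eq hV]
  exact mul_ne_zero (Nat.cast_ne_zero.2 N.factorial_ne_zero) (Finset.prod_ne_zero_iff.2 fun i _ =>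
    Complex.ofReal_ne_zero.2 ((monicOrthPoly_spec hV).2.2 i).ne')

theorem averageIntegrand_eq (f : Matrix (Fin N) (Fin N) ℂ → ℂ) (x : Fin N → ℝ) :
    averageIntegrand V N f x = (partitionFunction V N : ℂ)⁻¹ *
      ((unnormalizedDensity V N x : ℂ) * f (Matrix.diagonal fun i => (x i : ℂ))) := by
  rw [averageIntegrand, eigenvalueDensity]
  push_cast
  ring

/-- Since Δ(ε,μ) = Δ(ε) Δ(μ) ∏ (μ_j - ε_i), the prefactor is the reciprocal of the Cauchy
determinant. This also shows that the latter is nonzero, so it can be cancelled from the average. -/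
theorem det_cauchy_inv {K : ℕ} {ε μ : Fin K → ℂ} (hε : Function.Injective ε)
    (hμ : Function.Injective μ) (hεμ : ∀ i j, ε i ≠ μ j) :
    (Matrix.of fun a j => 1 / (μ j - ε a)).det *
      ((-1 : ℂ) ^ (K * (K - 1) / 2) * (vdet (Fin.append ε μ) / (vdet ε ^ 2 * vdet μ ^ 2))) = 1 := by
  have h := det_cauchy hε (u := μ) (fun i j => (hεμ j i).symm)
  have hε0 : (Matrix.vandermonde ε).det ≠ 0 := Matrix.det_vandermonde_ne_zero_iff.2 hε
  have hμ0 : (Matrix.vandermonde μ).det ≠ 0 := Matrix.det_vandermonde_ne_zero_iff.2 hμ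
  have hT : (Matrix.of fun a j => 1 / (μ j - ε a)).det =
      (Matrix.of fun i j => 1 / (μ i - ε j)).det := by
    rw [← Matrix.det_transpose]
    rfl
  have hs : (-1 : ℂ) ^ (K * (K - 1) / 2) * (-1 : ℂ) ^ (K * (K - 1) / 2) = 1 := by
    rw [← mul_pow]; norm_num
  rw [hT, vdet, vdet, vdet, det_vandermonde_append, Finset.prod_comm]
  field_simp
  linear_combination (-1 : ℂ) ^ (K * (K - 1) / 2) * h +
    (Matrix.vandermonde ε).det * (Matrix.vandermonde μ).det * hs

end Ensemble

end UnitaryEnsemble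

end

theorem proposition4p2 (V : ℝ → ℝ) (N K : ℕ) (hN : 1 ≤ N)
    (hV : UnitaryEnsemble.FiniteMoments V N)
    (ε μ : Fin K → ℂ)
    (hε_im : ∀ j, (ε j).im ≠ 0)
    (hε : Function.Injective ε) (hμ : Function.Injective μ)
    (hεμ : ∀ i j, ε i ≠ μ j) :
    Integrable (UnitaryEnsemble.averageIntegrand V N (UnitaryEnsemble.charRatio ε μ)) ∧
    UnitaryEnsemble.average V N (UnitaryEnsemble.charRatio ε μ) =
      (-1 : ℂ) ^ (K * (K - 1) / 2) * UnitaryEnsemble.gammaCoeff V N (N - 1) ^ K *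
        (UnitaryEnsemble.vdet (Fin.append ε μ) /
          (UnitaryEnsemble.vdet ε ^ 2 * UnitaryEnsemble.vdet μ ^ 2)) *
        (Matrix.of fun i j : Fin K => UnitaryEnsemble.kernelII V N (ε i) (μ j)).det := by
  open UnitaryEnsemble in
  obtain ⟨hint, hval⟩ := integrable_integral_unnormalized hV hε_im hμ hεμ
  have hD := det_cauchy_inv hε hμ hεμ
  have hZ := partitionFunction_ne_zero hV
  have hcell := fun a j => gammaCoeff_mul_kernelII hV hN (hε_im a) (hεμ a j)
  simp only [hcell] at hval
  have hdet : (Matrix.of fun a j : Fin K =>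
      gammaCoeff V N (N - 1) * kernelII V N (ε a) (μ j)).det =
      gammaCoeff V N (N - 1) ^ K * (Matrix.of fun a j : Fin K => kernelII V N (ε a) (μ j)).det := by
    have h := Matrix.det_smul (Matrix.of fun a j : Fin K => kernelII V N (ε a) (μ j))
      (gammaCoeff V N (N - 1))
    rwa [Fintype.card_fin] at h
  rw [hdet, ← partitionFunction_eq hV, integral_mul_const] at hval
  have hfun := funext (averageIntegrand_eq (V := V) (charRatio (N := N) ε μ))
  set D := (Matrix.of fun a j => 1 / (μ j - ε a)).det
  have hD0 : D ≠ 0 := left_ne_zero_of_mul_eq_one hD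
  refine ⟨?_, ?_⟩
  · rw [hfun]
    refine Integrable.const_mul ?_ _
    exact (integrable_mul_const_iff hD0.isUnit _).1 hint
  · rw [UnitaryEnsemble.average, hfun, integral_const_mul]
    set I := ∫ x : Fin N → ℝ, (unnormalizedDensity V N x : ℂ) *
      charRatio ε μ (Matrix.diagonal fun i => (x i : ℂ))
    set s := (-1 : ℂ) ^ (K * (K - 1) / 2)
    rw [inv_mul_eq_iff_eq_mul₀ hZ]
    -- The integral is known only after multiplication by the Cauchy determinant `D`; `hD` then
    -- trades `D` for the prefactor.
    apply mul_right_cancel₀ hD0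
    linear_combination hval - (partitionFunction V N : ℂ) * gammaCoeff V N (N - 1) ^ K *
      (Matrix.of fun a j : Fin K => kernelII V N (ε a) (μ j)).det * hD
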